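/- **Theorem (Finite Determinacy Theorem).** Let $(R,\mathfrak m)$ be a complete Noetherian local ring, let $R[[\underline{x}]]=R[[x_1,\dots,x_n]]$ with $n\ge 0$, let $I\subsetneq R[[\underline{x}]]$ be a proper ideal, let $0\neq f\in I^2$, and let $k\ge 0$ be an integer. Let $J(f)=\langle \partial f/\partial x_1,\dots,\partial f/\partial x_n\rangle$ be the ideal generated by the partial derivatives of $f$, and let $\operatorname{ord}_I(f)$ be the largest integer $j\ge 0$ such that $f\in I^j$ (it exists since $I$ is proper and $f\ne 0$). Suppose that $$I^{k+2}\subset I\cdot\langle f\rangle+I^2\cdot J(f).$$ Then $N:=2k-\operatorname{ord}_I(f)+2$ is non-negative and $f$ is $N$-determined with respect to $I$; that is, for every $g\in R[[\underline{x}]]$ with $f-g\in I^{N+1}$, we have $g \in I$ and there is an $R$-algebra automorphism $\varphi$ of $R[[\underline{x}]]$ with $\varphi(I)=I$ and $\langle f\rangle=\langle\varphi(g)\rangle$. -/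

import Mathlib

namespace Determinacy

/-- The ring `R[[x₁, …, xₙ]]` of formal power series. -/
abbrev PSeries (R : Type*) [CommRing R] (n : ℕ) : Type _ := MvPowerSeries (Fin n) R

variable {R : Type*} [CommRing R] {n : ℕ}

/-- `J(f)`: the ideal generated by the partial derivatives `∂₁ f, …, ∂ₙ f`. -/
noncomputable def jacobianIdeal (f : PSeries R n) : Ideal (PSeries R n) :=
  Ideal.span (Set.range fun i : Fin n => MvPowerSeries.pderiv R i f)

/-- `ord_I(f)`: the largest `j ≥ 0` with `f ∈ I ^ j`. Such a `j` exists over a Noetherian local ring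
when `I` is proper and `f ≠ 0`, see `isGreatest_ordI`; if there is no largest `j`, the value is the
meaningless `0`. -/
noncomputable def ordI (I : Ideal (PSeries R n)) (f : PSeries R n) : ℕ :=
  sSup {j : ℕ | f ∈ I ^ j}

theorem isGreatest_ordI [IsLocalRing R] [IsNoetherianRing R] {I : Ideal (PSeries R n)}
    (hI : I ≠ ⊤) {f : PSeries R n} (hf : f ≠ 0) :
    IsGreatest {j : ℕ | f ∈ I ^ j} (ordI I f) := by
  have hex : ∃ m, f ∉ I ^ m := by
    by_contra! h
    have h2 : f ∈ (⨅ i : ℕ, I ^ i) := by simpa [Submodule.mem_iInf] using h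
    rw [Ideal.iInf_pow_eq_bot_of_isLocalRing I hI] at h2
    exact hf (by simpa using h2)
  obtain ⟨m, hm⟩ := hex
  have hb : BddAbove {j : ℕ | f ∈ I ^ j} :=
    ⟨m, fun j hj => not_lt.1 fun hlt => hm (Ideal.pow_le_pow_right hlt.le hj)⟩
  have hne : {j : ℕ | f ∈ I ^ j}.Nonempty := ⟨0, by simp⟩
  exact ⟨Nat.sSup_mem hne hb, fun j hj => le_csSup hb hj⟩

/-- The group `𝒟_I` of the `R`-automorphisms `φ` of `R[[x₁, …, xₙ]]` with `φ(I) = I`. -/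
def autGroup (I : Ideal (PSeries R n)) : Subgroup (PSeries R n ≃ₐ[R] PSeries R n) where
  carrier := {φ | φ '' (I : Set (PSeries R n)) = I}
  one_mem' := Set.image_id _
  mul_mem' := by
    intro a b ha hb
    calc (a * b) '' (I : Set (PSeries R n)) = a '' (b '' (I : Set (PSeries R n))) :=
          Set.image_comp a b _
      _ = I := by rw [show b '' (I : Set (PSeries R n)) = I from hb,
          show a '' (I : Set (PSeries R n)) = I from ha]
  inv_mem' := by
    intro a ha
    have ha' : a '' (I : Set (PSeries R n)) = I := ha
    calc a.symm '' (I : Set (PSeries R n)) = a.symm '' (a '' (I : Set (PSeries R n))) := by rw [ha']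
      _ = I := a.toEquiv.symm_image_image _

/-- Contact equivalence of elements of `I` by automorphisms that preserve `I`. -/
def ContactEquiv (I : Ideal (PSeries R n)) (f g : PSeries R n) : Prop :=
  f ∈ I ∧ g ∈ I ∧ ∃ φ ∈ autGroup I, Ideal.span {f} = Ideal.span {φ g}

/-- `f` is `N`-determined with respect to `I`. -/
def IsDetermined (I : Ideal (PSeries R n)) (N : ℕ) (f : PSeries R n) : Prop :=
  ∀ g : PSeries R n, f - g ∈ I ^ (N + 1) → ContactEquiv I f g

end Determinacy

/-! Write ord_I(f) = o + 1 and c = k - o, so that N + 1 = c + k + 2. Multiplying the hypothesis by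
I^c writes any error r ∈ I^(c+k+2) as r = u f + D f, where u ∈ I^(c+1) and D = ∑ aᵢ ∂ᵢ with aᵢ ∈
I^(c+2). The substitution e : xᵢ ↦ xᵢ + aᵢ satisfies e f = f + D f + T f with a second-order
remainder T, so (1 + u) e f differs from f + r only by u D f and (1 + u) T f. Both lie in I^(o+2c+3)
= I^(c+k+3) because f ∈ I^(o+1). Thus the error gains one order (`exists_correction`). Iterating and
passing to the I-adic limit gives g = w · e f with w a unit and e ≡ id mod I²
(`exists_eq_mul_apply`), and φ = e⁻¹. That c and N are non-negative is Nakayama's lemma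
(`le_of_mem_pow`).

Two facts support this. R[[x]] is a complete Noetherian local ring whose ideals are all closed by
Krull's theorem, so I-adic limits exist and congruences between substitutions can be checked on
polynomials. The remainder T obeys a product rule, which bounds it without dividing by factorials.
-/

open IsLocalRing

/-! ### Powers of the maximal ideal and completeness of R[[x]]. -/

namespace MvPowerSeries
variable {σ R : Type*} [CommRing R]

/-- R[[x]] is the completion of R[x] at the finitely generated ideal of the variables, and there the
kernel of reduction modulo the j-th power is generated by that power. -/
theorem mem_span_range_X_pow_of_truncTotal_eq_zero [Finite σ] {j : ℕ} {p : MvPowerSeries σ R}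
    (hp : p.truncTotal j = 0) :
    p ∈ (Ideal.span (Set.range X) : Ideal (MvPowerSeries σ R)) ^ j := by
  have h1 : toAdicCompletion σ R p ∈
      ((MvPolynomial.idealOfVars σ R) ^ j • ⊤ : Submodule (MvPolynomial σ R)
        (AdicCompletion (MvPolynomial.idealOfVars σ R) (MvPolynomial σ R))) := by
    rw [AdicCompletion.pow_smul_top_eq_ker_eval (MvPolynomial.idealOfVars_fg σ R),
      LinearMap.mem_ker, AdicCompletion.eval_apply, toAdicCompletion_apply_eq_mk_truncTotal, hp]
    simp
  have h2 : p ∈ ((MvPolynomial.idealOfVars σ R) ^ j • ⊤ :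
      Submodule (MvPolynomial σ R) (MvPowerSeries σ R)) := by
    have h := Submodule.mem_map_of_mem (f := (toAdicCompletionAlgEquiv σ R).symm.toLinearMap) h1
    rw [Submodule.map_smul'', AlgEquiv.toLinearMap_apply, ← toAdicCompletionAlgEquiv_apply,
      AlgEquiv.symm_apply_apply] at h
    exact Submodule.smul_mono le_rfl le_top h
  have h3 : (MvPolynomial.idealOfVars σ R).map
      (algebraMap (MvPolynomial σ R) (MvPowerSeries σ R)) = Ideal.span (Set.range X) := by
    rw [MvPolynomial.idealOfVars, Ideal.map_span, ← Set.range_comp]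
    congr 2
    ext1 i
    simp [← MvPolynomial.coe_X, algebraMap_apply']
  rwa [Ideal.smul_top_eq_map, Submodule.restrictScalars_mem, Ideal.map_pow, h3] at h2

theorem sub_truncTotal_mem [Finite σ] (j : ℕ) (p : MvPowerSeries σ R) :
    p - (p.truncTotal j : MvPolynomial σ R) ∈
      (Ideal.span (Set.range X) : Ideal (MvPowerSeries σ R)) ^ j := by
  apply mem_span_range_X_pow_of_truncTotal_eq_zero
  classical
  ext d
  by_cases hd : d.degree < j
  · simp [coeff_truncTotal _ hd]
  · simp [coeff_truncTotal_eq_zero _ (not_lt.1 hd)]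

section LocalRing
variable [IsLocalRing R]

theorem mem_maximalIdeal_iff {p : MvPowerSeries σ R} :
    p ∈ maximalIdeal (MvPowerSeries σ R) ↔ constantCoeff p ∈ maximalIdeal R := by
  simp [mem_nonunits_iff, isUnit_iff_constantCoeff]

theorem X_mem_maximalIdeal (i : σ) : (X i : MvPowerSeries σ R) ∈ maximalIdeal _ := by
  rw [mem_maximalIdeal_iff]; simp

theorem span_range_X_le_maximalIdeal :
    (Ideal.span (Set.range X) : Ideal (MvPowerSeries σ R)) ≤ maximalIdeal _ :=
  Ideal.span_le.2 (by rintro _ ⟨i, rfl⟩; exact X_mem_maximalIdeal i)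

theorem map_C_maximalIdeal_le :
    (maximalIdeal R).map (C : R →+* MvPowerSeries σ R) ≤ maximalIdeal _ :=
  Ideal.map_le_iff_le_comap.2 fun r hr => by
    rw [Ideal.mem_comap, mem_maximalIdeal_iff]; simpa using hr

theorem sub_truncTotal_mem_maximalIdeal_pow [Finite σ] (j : ℕ) (p : MvPowerSeries σ R) :
    p - (p.truncTotal j : MvPolynomial σ R) ∈ maximalIdeal (MvPowerSeries σ R) ^ j :=
  Ideal.pow_right_mono span_range_X_le_maximalIdeal j (sub_truncTotal_mem j p)

/-- A factor from the maximal ideal contributes either a constant term in the maximal ideal of R or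
a positive degree. With the converse below, this reduces completeness of R[[x]] to that of R. The
truncated subtraction makes the condition vacuous in degrees at least j. -/
theorem coeff_mem_of_mem_maximalIdeal_pow {j : ℕ} {p : MvPowerSeries σ R}
    (hp : p ∈ maximalIdeal (MvPowerSeries σ R) ^ j) (d : σ →₀ ℕ) :
    coeff d p ∈ maximalIdeal R ^ (j - d.degree) := by
  classical
  induction j generalizing p d with
  | zero => simp
  | succ j ih =>
    rw [pow_succ] at hp
    refine Submodule.mul_induction_on hp (fun a ha b hb => ?_) (fun a b ha hb => ?_)
    · rw [coeff_mul]
      refine Ideal.sum_mem _ fun c hc => ?_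
      rw [Finset.HasAntidiagonal.mem_antidiagonal] at hc
      have hdeg : d.degree = c.1.degree + c.2.degree := by rw [← hc, map_add]
      by_cases h0 : c.2 = 0
      · have h1 := Ideal.mul_mem_mul (ih ha c.1) (mem_maximalIdeal_iff.1 hb)
        rw [← pow_succ] at h1
        rw [h0, coeff_zero_eq_constantCoeff_apply]
        rw [h0] at hdeg
        refine Ideal.pow_le_pow_right ?_ h1
        simp at hdeg; omega
      · have h2 : 0 < c.2.degree := Nat.pos_of_ne_zero
          (by simpa [Finsupp.degree_eq_zero_iff] using h0)
        exact Ideal.mul_mem_right _ _ (Ideal.pow_le_pow_right (by omega) (ih ha c.1))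
    · rw [map_add]; exact add_mem ha hb

theorem mem_maximalIdeal_pow_of_coeff_mem [Finite σ] {j : ℕ} {p : MvPowerSeries σ R}
    (hp : ∀ d, coeff d p ∈ maximalIdeal R ^ (j - d.degree)) :
    p ∈ maximalIdeal (MvPowerSeries σ R) ^ j := by
  rw [← sub_add_cancel p (p.truncTotal j : MvPolynomial σ R)]
  refine add_mem (sub_truncTotal_mem_maximalIdeal_pow j p) ?_
  rw [← (p.truncTotal j).support_sum_monomial_coeff,
    ← MvPolynomial.coeToMvPowerSeries.ringHom_apply, map_sum]
  refine Ideal.sum_mem _ fun d hd => ?_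
  have hdj : d.degree < j := by
    by_contra h
    exact MvPolynomial.mem_support_iff.1 hd (coeff_truncTotal_eq_zero _ (not_lt.1 h))
  rw [coeff_truncTotal _ hdj, MvPolynomial.monomial_eq, map_mul,
    Finsupp.prod, map_prod, show j = (j - d.degree) + d.degree by omega, pow_add]
  refine Ideal.mul_mem_mul ?_ ?_
  · refine Ideal.pow_right_mono map_C_maximalIdeal_le _ ?_
    rw [← Ideal.map_pow]
    simpa using Ideal.mem_map_of_mem (C : R →+* MvPowerSeries σ R) (hp d)
  · rw [Finsupp.degree_apply, ← Finset.prod_pow_eq_pow_sum]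
    refine Ideal.prod_mem_prod fun i _ => ?_
    simpa using Ideal.pow_mem_pow (X_mem_maximalIdeal i) _

instance isPrecomplete_maximalIdeal [Finite σ] [IsPrecomplete (maximalIdeal R) R] :
    IsPrecomplete (maximalIdeal (MvPowerSeries σ R)) (MvPowerSeries σ R) := by
  refine ⟨fun y hy => ?_⟩
  simp only [smul_eq_mul, Ideal.mul_top, SModEq.sub_mem] at hy ⊢
  -- The index is shifted by the degree of d, since precision j of a series gives only precision j -
  -- |d| of its coefficient at d.
  have hlim : ∀ d : σ →₀ ℕ, ∃ l : R, ∀ j,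
      coeff d (y (j + d.degree)) - l ∈ maximalIdeal R ^ j := by
    intro d
    obtain ⟨l, hl⟩ := IsPrecomplete.prec (I := maximalIdeal R) (M := R) inferInstance
      (f := fun j => coeff d (y (j + d.degree))) (by
        intro i j hij
        rw [smul_eq_mul, Ideal.mul_top, SModEq.sub_mem, ← map_sub]
        simpa using coeff_mem_of_mem_maximalIdeal_pow
          (hy (Nat.add_le_add_right hij d.degree)) d)
    exact ⟨l, fun j => by simpa [SModEq.sub_mem] using hl j⟩
  choose l hl using hlim
  refine ⟨fun d => l d, fun j => mem_maximalIdeal_pow_of_coeff_mem fun d => ?_⟩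
  have h1 := coeff_mem_of_mem_maximalIdeal_pow (hy (show j ≤ j - d.degree + d.degree by omega)) d
  have h2 := add_mem h1 (hl d (j - d.degree))
  rw [map_sub, sub_add_sub_cancel] at h2
  exact h2

end LocalRing
end MvPowerSeries

/-! ### Closed ideals and I-adic limits in Noetherian local rings. -/

section Noetherian
variable {A : Type*} [CommRing A] [IsLocalRing A] [IsNoetherianRing A]

/-- Krull's intersection theorem in A/J: every ideal is closed in the adic topology of the maximal
ideal. -/
theorem Ideal.mem_of_forall_mem_sup_maximalIdeal_pow {J : Ideal A} {x : A}
    (h : ∀ j : ℕ, x ∈ J ⊔ maximalIdeal A ^ j) : x ∈ J := by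
  rw [← Ideal.Quotient.eq_zero_iff_mem]
  refine IsHausdorff.haus (I := maximalIdeal A) (M := A ⧸ J) inferInstance _ fun j => ?_
  rw [SModEq.zero]
  obtain ⟨a, ha, b, hb, rfl⟩ := Submodule.mem_sup.1 (h j)
  rw [map_add, Ideal.Quotient.eq_zero_iff_mem.2 ha, zero_add]
  have := Submodule.smul_mem_smul hb (Submodule.mem_top (x := (1 : A ⧸ J)) (R := A))
  rwa [Algebra.smul_def, mul_one] at this

/-- An I-adic Cauchy sequence has a limit for the maximal ideal. It is also an I-adic limit because
each I^i is closed. -/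
theorem IsPrecomplete.of_ne_top [IsPrecomplete (maximalIdeal A) A] {I : Ideal A} (hI : I ≠ ⊤) :
    IsPrecomplete I A := by
  refine ⟨fun y hy => ?_⟩
  simp only [smul_eq_mul, Ideal.mul_top, SModEq.sub_mem] at hy ⊢
  obtain ⟨l, hl⟩ := IsPrecomplete.prec (I := maximalIdeal A) (M := A) inferInstance (f := y) (by
    intro i j hij
    rw [smul_eq_mul, Ideal.mul_top, SModEq.sub_mem]
    exact Ideal.pow_right_mono (le_maximalIdeal hI) i (hy hij))
  simp only [smul_eq_mul, Ideal.mul_top, SModEq.sub_mem] at hl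
  refine ⟨l, fun i => Ideal.mem_of_forall_mem_sup_maximalIdeal_pow fun j => ?_⟩
  rw [← sub_add_sub_cancel _ (y (max i j))]
  exact add_mem (Ideal.mem_sup_left (hy (le_max_left i j))) (Ideal.mem_sup_right
    (Ideal.pow_le_pow_right (le_max_right i j) (hl _)))

end Noetherian

/-! ### Substitution homomorphisms and their continuity. -/

namespace MvPowerSeries
variable {σ R : Type*} [CommRing R]

/-- Substituting into truncations gives compatible maps to the quotients S/J^j, which glue by
completeness. -/
theorem exists_algHom_apply_X [Finite σ] {S : Type*} [CommRing S] [Algebra R S] (J : Ideal S)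
    [IsAdicComplete J S] (b : σ → S) (hb : ∀ i, b i ∈ J) :
    ∃ φ : MvPowerSeries σ R →ₐ[R] S, ∀ i, φ (X i) = b i := by
  have hvars : ∀ j : ℕ, MvPolynomial.idealOfVars σ R ^ j ≤
      (J ^ j).comap (MvPolynomial.aeval (R := R) b) := fun j =>
    (Ideal.pow_right_mono (Ideal.span_le.2 (by rintro _ ⟨i, rfl⟩; simpa using hb i)) j).trans
      (Ideal.le_comap_pow _ j)
  let F : (j : ℕ) → MvPowerSeries σ R →ₐ[R] S ⧸ J ^ j := fun j =>
    (Ideal.quotientMapₐ (J ^ j) (MvPolynomial.aeval (R := R) b) (hvars j)).comp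
      ((truncTotalAlgHom σ R j).restrictScalars R)
  have hF : ∀ j p, F j p = Ideal.Quotient.mk (J ^ j) (MvPolynomial.aeval b (p.truncTotal j)) :=
    fun _ _ => rfl
  have hcomp : ∀ {m n : ℕ} (hle : m ≤ n),
      (Ideal.Quotient.factorₐ R (Ideal.pow_le_pow_right hle)).comp (F n) = F m := by
    intro m n hle
    ext p
    rw [AlgHom.comp_apply, hF, hF, Ideal.Quotient.factorₐ_apply_mk,
      Ideal.Quotient.mk_eq_mk_iff_sub_mem,
      ← map_sub]
    exact hvars m (truncTotal_sub_truncTotal_mem_pow_idealOfVars hle le_rfl p)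
  refine ⟨IsAdicComplete.liftAlgHom J F hcomp, fun i => ?_⟩
  refine (IsHausdorff.eq_iff_smodEq (I := J)).2 fun j => ?_
  rw [smul_eq_mul, Ideal.mul_top, SModEq.sub_mem, ← Ideal.Quotient.mk_eq_mk_iff_sub_mem,
    IsAdicComplete.mk_liftAlgHom, hF, Ideal.Quotient.mk_eq_mk_iff_sub_mem,
    ← MvPolynomial.aeval_X (R := R) b i, ← map_sub]
  refine hvars j ((MvPolynomial.mem_pow_idealOfVars_iff' ..).2 fun x hx => ?_)
  rw [MvPolynomial.coeff_sub, coeff_truncTotal _ hx, ← MvPolynomial.coe_X,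
    MvPolynomial.coeff_coe, sub_self]

section LocalRing
variable [IsLocalRing R] [Finite σ]

/-- Continuity is automatic: with finitely many variables, a series without constant term lies in
the ideal generated by the variables, and constants are fixed. -/
theorem apply_mem_maximalIdeal {φ : MvPowerSeries σ R →ₐ[R] MvPowerSeries σ R}
    (hφ : ∀ i, φ (X i) ∈ maximalIdeal (MvPowerSeries σ R)) {p : MvPowerSeries σ R}
    (hp : p ∈ maximalIdeal (MvPowerSeries σ R)) : φ p ∈ maximalIdeal (MvPowerSeries σ R) := by
  have h1 : Ideal.span (Set.range X) ≤ (maximalIdeal (MvPowerSeries σ R)).comap φ :=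
    Ideal.span_le.2 (by rintro _ ⟨i, rfl⟩; exact hφ i)
  have h2 : p - algebraMap R _ (constantCoeff p) ∈ Ideal.span (Set.range X) := by
    rw [← pow_one (Ideal.span (Set.range X))]
    refine mem_span_range_X_pow_of_truncTotal_eq_zero ?_
    ext d
    by_cases hd : d.degree < 1
    · rw [coeff_truncTotal _ hd]
      have : d = 0 := by simpa [Finsupp.degree_eq_zero_iff] using hd
      subst this
      simp [algebraMap_apply]
    · simp [coeff_truncTotal_eq_zero _ (not_lt.1 hd)]
  rw [← sub_add_cancel p (algebraMap R _ (constantCoeff p)), map_add, AlgHom.commutes]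
  refine add_mem (h1 h2) ?_
  rw [mem_maximalIdeal_iff] at hp ⊢
  simpa [algebraMap_apply] using hp

theorem apply_mem_maximalIdeal_pow {φ : MvPowerSeries σ R →ₐ[R] MvPowerSeries σ R}
    (hφ : ∀ i, φ (X i) ∈ maximalIdeal (MvPowerSeries σ R)) {p : MvPowerSeries σ R} {j : ℕ}
    (hp : p ∈ maximalIdeal (MvPowerSeries σ R) ^ j) :
    φ p ∈ maximalIdeal (MvPowerSeries σ R) ^ j :=
  (Ideal.pow_right_mono (fun _ h => apply_mem_maximalIdeal hφ h) j).trans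
    (Ideal.le_comap_pow φ j) hp

variable [IsNoetherianRing R]

/-- An additive map that is continuous for the adic topology of the maximal ideal and maps the
polynomials to `J` maps everything to `J`. -/
theorem apply_mem_of_forall_coe_mem {T : MvPowerSeries σ R →+ MvPowerSeries σ R}
    (hT : ∀ j, ∀ p ∈ maximalIdeal (MvPowerSeries σ R) ^ j, T p ∈ maximalIdeal _ ^ (j - 1))
    {J : Ideal (MvPowerSeries σ R)} (hJ : ∀ q : MvPolynomial σ R, T q ∈ J)
    (p : MvPowerSeries σ R) : T p ∈ J := by
  refine Ideal.mem_of_forall_mem_sup_maximalIdeal_pow fun j => ?_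
  rw [← sub_add_cancel p (p.truncTotal (j + 1) : MvPolynomial σ R), map_add]
  exact add_mem
    (Ideal.mem_sup_right (hT (j + 1) _ (sub_truncTotal_mem_maximalIdeal_pow (j + 1) p)))
    (Ideal.mem_sup_left (hJ _))

theorem sub_mem_of_X_sub_mem {φ ψ : MvPowerSeries σ R →ₐ[R] MvPowerSeries σ R}
    (hφ : ∀ i, φ (X i) ∈ maximalIdeal (MvPowerSeries σ R))
    (hψ : ∀ i, ψ (X i) ∈ maximalIdeal (MvPowerSeries σ R))
    {J : Ideal (MvPowerSeries σ R)} (h : ∀ i, φ (X i) - ψ (X i) ∈ J) (p : MvPowerSeries σ R) :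
    φ p - ψ p ∈ J := by
  refine apply_mem_of_forall_coe_mem (T := (φ.toLinearMap - ψ.toLinearMap).toAddMonoidHom)
    (fun j p hp => ?_) (fun q => ?_) p
  · exact sub_mem
      (Ideal.pow_le_pow_right (Nat.sub_le j 1) (apply_mem_maximalIdeal_pow hφ hp))
      (Ideal.pow_le_pow_right (Nat.sub_le j 1) (apply_mem_maximalIdeal_pow hψ hp))
  · change φ q - ψ q ∈ J
    rw [← Ideal.Quotient.mk_eq_mk_iff_sub_mem]
    have : ((Ideal.Quotient.mkₐ R J).comp φ).comp (MvPolynomial.coeToMvPowerSeries.algHom R) =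
        ((Ideal.Quotient.mkₐ R J).comp ψ).comp (MvPolynomial.coeToMvPowerSeries.algHom R) := by
      refine MvPolynomial.algHom_ext fun i => ?_
      simpa [MvPolynomial.coeToMvPowerSeries.algHom_apply, Ideal.Quotient.mk_eq_mk_iff_sub_mem]
        using h i
    simpa [MvPolynomial.coeToMvPowerSeries.algHom_apply] using DFunLike.congr_fun this q

end LocalRing
end MvPowerSeries

/-! ### Derivations and second-order Taylor remainders. -/

/-- A derivation lowers the order of vanishing along an ideal by at most one. -/
theorem Derivation.apply_mem_mul_pow {R A : Type*} [CommRing R] [CommRing A] [Algebra R A]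
    (D : Derivation R A A) {I J : Ideal A} (hD : ∀ a, D a ∈ J) {m : ℕ} {a : A}
    (ha : a ∈ I ^ (m + 1)) : D a ∈ J * I ^ m := by
  induction m generalizing a with
  | zero => simpa using hD a
  | succ m ih =>
    rw [pow_succ] at ha
    refine Submodule.mul_induction_on ha (fun x hx y hy => ?_) (fun x y hx hy => ?_)
    · rw [D.leibniz, smul_eq_mul, smul_eq_mul]
      refine add_mem ?_ ?_
      · rw [mul_comm x]; exact Ideal.mul_mem_mul (hD y) hx
      · rw [pow_succ' I m, mul_left_comm]
        exact Ideal.mul_mem_mul hy (ih hx)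
    · rw [map_add]; exact add_mem hx hy

/-- The second-order Taylor remainder of `φ` with respect to a derivation `D`. -/
def AlgHom.taylorRemainder {R A : Type*} [CommRing R] [CommRing A] [Algebra R A] (φ : A →ₐ[R] A)
    (D : Derivation R A A) : A →ₗ[R] A :=
  φ.toLinearMap - LinearMap.id - (D : A →ₗ[R] A)

theorem AlgHom.taylorRemainder_apply {R A : Type*} [CommRing R] [CommRing A] [Algebra R A]
    (φ : A →ₐ[R] A) (D : Derivation R A A) (a : A) :
    φ.taylorRemainder D a = φ a - a - D a := rfl

/-- Since D + T = φ - id, the last term is the product of the two first-order differences. This rule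
takes the place of Taylor's formula in every characteristic. -/
theorem AlgHom.taylorRemainder_mul {R A : Type*} [CommRing R] [CommRing A] [Algebra R A]
    (φ : A →ₐ[R] A) (D : Derivation R A A) (a b : A) :
    φ.taylorRemainder D (a * b) = a * φ.taylorRemainder D b + b * φ.taylorRemainder D a +
      (D a + φ.taylorRemainder D a) * (D b + φ.taylorRemainder D b) := by
  simp only [taylorRemainder_apply, map_mul, D.leibniz, smul_eq_mul]
  ring

/-- A second-order term costs two powers of I and gains the 2s powers from its coefficients. -/
theorem AlgHom.taylorRemainder_mem_pow {R A : Type*} [CommRing R] [CommRing A] [Algebra R A]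
    {φ : A →ₐ[R] A} {D : Derivation R A A} {I : Ideal A} {s : ℕ} (hs : 1 ≤ s)
    (hD : ∀ a, D a ∈ I ^ s) (hT : ∀ a, φ.taylorRemainder D a ∈ I ^ (2 * s)) {m : ℕ} {a : A}
    (ha : a ∈ I ^ m) : φ.taylorRemainder D a ∈ I ^ (m + 2 * s - 2) := by
  induction m generalizing a with
  | zero => exact Ideal.pow_le_pow_right (by omega) (hT a)
  | succ m ih =>
    rw [pow_succ] at ha
    refine Submodule.mul_induction_on ha (fun x hx y hy => ?_) (fun x y hx hy => ?_)
    · have hmul : ∀ {p q : A} {c d e : ℕ}, p ∈ I ^ c → q ∈ I ^ d → e ≤ c + d → p * q ∈ I ^ e :=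
        fun hp hq h => Ideal.pow_le_pow_right h (by rw [pow_add]; exact Ideal.mul_mem_mul hp hq)
      have hy1 : y ∈ I ^ 1 := by simpa using hy
      have hDx : D x ∈ I ^ (m + s - 1) := by
        cases m with
        | zero => exact Ideal.pow_le_pow_right (by omega) (hD x)
        | succ m =>
          have := D.apply_mem_mul_pow hD hx
          rw [← pow_add] at this
          exact Ideal.pow_le_pow_right (by omega) this
      have hTx := ih hx
      rw [AlgHom.taylorRemainder_mul]
      refine add_mem (add_mem (hmul hx (hT y) (by omega)) (hmul hy1 hTx (by omega))) ?_
      refine hmul (c := m + s - 1) (d := s) (add_mem hDx (Ideal.pow_le_pow_right (by omega) hTx))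
        (add_mem (hD y) (Ideal.pow_le_pow_right (by omega) (hT y))) (by omega)
    · rw [map_add]; exact add_mem hx hy

namespace MvPowerSeries
variable {σ R : Type*} [CommRing R]

section LocalRing
variable [IsLocalRing R] [IsNoetherianRing R] [Finite σ]

/-- The remainder vanishes on constants and variables, so the product rule settles polynomials, and
density with closedness of J² settles all series. -/
theorem taylorRemainder_mem_sq {φ : MvPowerSeries σ R →ₐ[R] MvPowerSeries σ R}
    {D : Derivation R (MvPowerSeries σ R) (MvPowerSeries σ R)}
    (hX : ∀ i, φ (X i) = X i + D (X i)) {J : Ideal (MvPowerSeries σ R)} (hJ : J ≠ ⊤)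
    (hD : ∀ p, D p ∈ J) (p : MvPowerSeries σ R) : φ.taylorRemainder D p ∈ J ^ 2 := by
  have hφM : ∀ i, φ (X i) ∈ maximalIdeal (MvPowerSeries σ R) := fun i => by
    rw [hX]; exact add_mem (X_mem_maximalIdeal i) (le_maximalIdeal hJ (hD _))
  have hmem : ∀ p, D p + φ.taylorRemainder D p ∈ J := fun p => by
    rw [AlgHom.taylorRemainder_apply, add_sub_cancel]
    refine sub_mem_of_X_sub_mem (ψ := AlgHom.id R _) hφM X_mem_maximalIdeal (fun i => ?_) p
    rw [AlgHom.id_apply, hX, add_sub_cancel_left]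
    exact hD _
  refine apply_mem_of_forall_coe_mem (T := (φ.taylorRemainder D).toAddMonoidHom)
    (fun j p hp => ?_) (fun q => ?_) p
  · have h1 : φ p - p ∈ maximalIdeal (MvPowerSeries σ R) ^ (j - 1) :=
      Ideal.pow_le_pow_right (Nat.sub_le j 1)
        (sub_mem (apply_mem_maximalIdeal_pow hφM hp) hp)
    have h2 : D p ∈ maximalIdeal (MvPowerSeries σ R) ^ (j - 1) := by
      rcases j with _ | j
      · simp
      · have h := D.apply_mem_mul_pow hD hp
        exact Ideal.mul_le_right h
    exact sub_mem h1 h2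
  · change φ.taylorRemainder D (q : MvPowerSeries σ R) ∈ J ^ 2
    induction q using MvPolynomial.induction_on with
    | C r =>
      have h : (MvPolynomial.C r : MvPolynomial σ R) = algebraMap R (MvPowerSeries σ R) r := by
        simp [algebraMap_apply]
      rw [h, AlgHom.taylorRemainder_apply, AlgHom.commutes, D.map_algebraMap, sub_self, sub_zero]
      exact zero_mem _
    | add p q hp hq => rw [MvPolynomial.coe_add, map_add]; exact add_mem hp hq
    | mul_X p i hp =>
      have h : φ.taylorRemainder D (X i) = 0 := by
        rw [AlgHom.taylorRemainder_apply, hX]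
        ring
      rw [MvPolynomial.coe_mul, MvPolynomial.coe_X, AlgHom.taylorRemainder_mul, h, mul_zero,
        zero_add, pow_two]
      rw [pow_two] at hp
      refine add_mem (Ideal.mul_mem_left _ _ hp) (Ideal.mul_mem_mul (hmem _) ?_)
      have := hmem (X i)
      rwa [h] at this

end LocalRing
end MvPowerSeries

/-! ### Endomorphisms congruent to the identity modulo I². -/

section Noetherian
variable {A : Type*} [CommRing A]

theorem RingHom.sub_mem_pow_succ_of_sub_mem_sq (φ : A →+* A) {I : Ideal A}
    (hφ : ∀ a, φ a - a ∈ I ^ 2) {j : ℕ} {a : A} (ha : a ∈ I ^ j) : φ a - a ∈ I ^ (j + 1) := by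
  induction j generalizing a with
  | zero => exact Ideal.pow_le_pow_right (by omega) (hφ a)
  | succ j ih =>
    rw [pow_succ] at ha
    refine Submodule.mul_induction_on ha (fun x hx y hy => ?_) (fun x y hx hy => ?_)
    · have h1 : φ y ∈ I := by
        rw [← sub_add_cancel (φ y) y]
        exact add_mem (Ideal.pow_le_self two_ne_zero (hφ y)) hy
      rw [map_mul, show φ x * φ y - x * y = (φ x - x) * φ y + x * (φ y - y) by ring]
      refine add_mem ?_ ?_
      · rw [pow_succ]; exact Ideal.mul_mem_mul (ih hx) h1
      · rw [add_assoc, pow_add]; exact Ideal.mul_mem_mul hx (hφ y)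
    · rw [map_add, add_sub_add_comm]; exact add_mem hx hy

variable [IsLocalRing A] [IsNoetherianRing A]

theorem Ideal.eq_zero_of_forall_mem_pow {I : Ideal A} (hI : I ≠ ⊤) {a : A}
    (h : ∀ j, a ∈ I ^ j) : a = 0 := by
  have h2 : a ∈ (⨅ i : ℕ, I ^ i) := by simpa [Submodule.mem_iInf] using h
  rwa [Ideal.iInf_pow_eq_bot_of_isLocalRing I hI, Ideal.mem_bot] at h2

theorem exists_forall_sub_mem_pow [IsPrecomplete (maximalIdeal A) A] {I : Ideal A} (hI : I ≠ ⊤)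
    {y : ℕ → A} (hy : ∀ j, y (j + 1) - y j ∈ I ^ j) : ∃ l, ∀ j, l - y j ∈ I ^ j := by
  have hmono : ∀ i d, y (i + d) - y i ∈ I ^ i := by
    intro i d
    induction d with
    | zero => simp
    | succ d ih =>
      rw [← add_assoc, ← sub_add_sub_cancel _ (y (i + d))]
      exact add_mem (Ideal.pow_le_pow_right (Nat.le_add_right i d) (hy _)) ih
  obtain ⟨l, hl⟩ := IsPrecomplete.prec (IsPrecomplete.of_ne_top hI) (f := y) (by
    intro i j hij
    obtain ⟨d, rfl⟩ := Nat.exists_eq_add_of_le hij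
    rw [smul_eq_mul, Ideal.mul_top, SModEq.sub_mem, ← neg_mem_iff, neg_sub]
    exact hmono i d)
  refine ⟨l, fun j => ?_⟩
  have := hl j
  rwa [smul_eq_mul, Ideal.mul_top, SModEq.sub_mem, ← neg_mem_iff, neg_sub] at this

/-- Such a map induces the identity on each I^j/I^(j+1). Injectivity follows from Krull's theorem,
surjectivity from successive approximation. -/
theorem RingHom.bijective_of_sub_mem_sq [IsPrecomplete (maximalIdeal A) A] (φ : A →+* A)
    {I : Ideal A} (hI : I ≠ ⊤) (hφ : ∀ a, φ a - a ∈ I ^ 2) : Function.Bijective φ := by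
  constructor
  · refine (injective_iff_map_eq_zero φ).2 fun a ha =>
      Ideal.eq_zero_of_forall_mem_pow hI fun j => ?_
    induction j with
    | zero => simp
    | succ j ih => simpa [ha] using φ.sub_mem_pow_succ_of_sub_mem_sq hφ ih
  · intro b
    -- Adding the defect b - φ(y) to y moves the defect one power of I deeper.
    let y : ℕ → A := fun j => Nat.rec 0 (fun _ a => a + (b - φ a)) j
    have hy : ∀ j, y (j + 1) = y j + (b - φ (y j)) := fun _ => rfl
    have hb : ∀ j, b - φ (y j) ∈ I ^ j := by
      intro j
      induction j with
      | zero => simp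
      | succ j ih =>
        have := φ.sub_mem_pow_succ_of_sub_mem_sq hφ ih
        rw [← neg_mem_iff] at this
        rw [hy, map_add]
        convert this using 1
        ring
    obtain ⟨l, hl⟩ := exists_forall_sub_mem_pow hI (y := y) fun j => by
      rw [hy, add_sub_cancel_left]; exact hb j
    refine ⟨l, (sub_eq_zero.1 (Ideal.eq_zero_of_forall_mem_pow hI fun j => ?_)).symm⟩
    have h1 : φ (l - y j) ∈ I ^ j := by
      rw [← sub_add_cancel (φ (l - y j)) (l - y j)]
      exact add_mem (Ideal.pow_le_pow_right (Nat.le_succ j)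
        (φ.sub_mem_pow_succ_of_sub_mem_sq hφ (hl j))) (hl j)
    have := sub_mem (hb j) h1
    rwa [map_sub, sub_sub, add_sub_cancel] at this

end Noetherian

theorem AlgEquiv.apply_mem_pow_of_sub_mem {R A : Type*} [CommRing R] [CommRing A] [Algebra R A]
    {e : A ≃ₐ[R] A} {I : Ideal A} (he : ∀ a, e a - a ∈ I) {j : ℕ} {a : A} (ha : a ∈ I ^ j) :
    e a ∈ I ^ j := by
  refine (Ideal.pow_right_mono (fun b hb => ?_) j).trans (Ideal.le_comap_pow e j) ha
  rw [Ideal.mem_comap, ← sub_add_cancel (e b) b]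
  exact add_mem (he b) hb

theorem AlgEquiv.symm_sub_mem {R A : Type*} [CommRing R] [CommRing A] [Algebra R A]
    {e : A ≃ₐ[R] A} {I : Ideal A} (he : ∀ a, e a - a ∈ I) (a : A) : e.symm a - a ∈ I := by
  have := he (e.symm a)
  rwa [e.apply_symm_apply, ← neg_mem_iff, neg_sub] at this

namespace MvPowerSeries

variable {σ R : Type*} [CommRing R] [IsLocalRing R] [IsNoetherianRing R] [Finite σ]

theorem algEquiv_sub_mem {I : Ideal (MvPowerSeries σ R)} (hI : I ≠ ⊤)
    {e : MvPowerSeries σ R ≃ₐ[R] MvPowerSeries σ R} {m : ℕ} (hm : m ≠ 0)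
    (he : ∀ i, e (X i) - X i ∈ I ^ m) (p : MvPowerSeries σ R) : e p - p ∈ I ^ m := by
  refine sub_mem_of_X_sub_mem (φ := e) (ψ := AlgHom.id R _) (fun i => ?_) X_mem_maximalIdeal he p
  change e (X i) ∈ _
  rw [← sub_add_cancel (e (X i)) (X i)]
  exact add_mem (le_maximalIdeal hI (Ideal.pow_le_self hm (he i))) (X_mem_maximalIdeal i)

theorem exists_algEquiv_apply_X [IsAdicComplete (maximalIdeal R) R]
    {I : Ideal (MvPowerSeries σ R)} (hI : I ≠ ⊤) (b : σ → MvPowerSeries σ R)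
    (hb : ∀ i, b i - X i ∈ I ^ 2) :
    ∃ e : MvPowerSeries σ R ≃ₐ[R] MvPowerSeries σ R, ∀ i, e (X i) = b i := by
  have : IsAdicComplete (maximalIdeal (MvPowerSeries σ R)) (MvPowerSeries σ R) := ⟨⟩
  have hbM : ∀ i, b i ∈ maximalIdeal (MvPowerSeries σ R) := fun i => by
    rw [← sub_add_cancel (b i) (X i)]
    exact add_mem (le_maximalIdeal hI (Ideal.pow_le_self two_ne_zero (hb i)))
      (X_mem_maximalIdeal i)
  obtain ⟨φ, hφ⟩ := exists_algHom_apply_X (R := R) (maximalIdeal (MvPowerSeries σ R)) b hbM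
  have hsub : ∀ p, φ p - p ∈ I ^ 2 :=
    sub_mem_of_X_sub_mem (ψ := AlgHom.id R _) (fun i => hφ i ▸ hbM i) X_mem_maximalIdeal
      fun i => by rw [hφ]; exact hb i
  exact ⟨AlgEquiv.ofBijective φ ((φ : _ →+* _).bijective_of_sub_mem_sq hI hsub), hφ⟩

end MvPowerSeries

/-! ### The tangent condition, the correction step and its iteration. -/

namespace Determinacy

open MvPowerSeries

variable {R : Type*} [CommRing R] {n : ℕ}

theorem jacobianIdeal_le {I : Ideal (PSeries R n)} {f : PSeries R n} {m : ℕ}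
    (hf : f ∈ I ^ (m + 1)) : jacobianIdeal f ≤ I ^ m := by
  refine Ideal.span_le.2 ?_
  rintro _ ⟨i, rfl⟩
  simpa using (pderiv R i).apply_mem_mul_pow (J := ⊤) (fun _ => trivial) hf

/-- If f ∈ I^(k+2), then J(f) ⊆ I^(k+1), so the tangent condition gives I^(k+2) ⊆ I · I^(k+2).
Nakayama's lemma then forces I^(k+2) = 0, hence f = 0. -/
theorem le_of_mem_pow [IsLocalRing R] [IsNoetherianRing R] {I : Ideal (PSeries R n)} (hI : I ≠ ⊤)
    {f : PSeries R n} (hf0 : f ≠ 0) {k o : ℕ}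
    (h : I ^ (k + 2) ≤ I * Ideal.span {f} + I ^ 2 * jacobianIdeal f) (hf : f ∈ I ^ o) :
    o ≤ k + 1 := by
  by_contra! ho
  have hf2 : f ∈ I ^ (k + 2) := Ideal.pow_le_pow_right ho hf
  have hle : I ^ (k + 2) ≤ I • I ^ (k + 2) := by
    refine h.trans (sup_le ?_ ?_)
    · exact Ideal.mul_mono_right ((Ideal.span_singleton_le_iff_mem _).2 hf2)
    · calc I ^ 2 * jacobianIdeal f ≤ I ^ 2 * I ^ (k + 1) :=
          Ideal.mul_mono_right (jacobianIdeal_le hf2)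
        _ = I • I ^ (k + 2) := by rw [smul_eq_mul]; ring
  have hbot := Submodule.eq_bot_of_le_smul_of_le_jacobson_bot I (I ^ (k + 2))
    (IsNoetherian.noetherian _) hle ((le_maximalIdeal hI).trans (maximalIdeal_le_jacobson _))
  rw [hbot] at hf2
  exact hf0 (by simpa using hf2)

/-- The tangent space condition gives a first-order correction of a perturbation of `f`. -/
theorem exists_eq_mul_add_sum {I : Ideal (PSeries R n)} {f : PSeries R n} {k c : ℕ}
    (h : I ^ (k + 2) ≤ I * Ideal.span {f} + I ^ 2 * jacobianIdeal f) {r : PSeries R n}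
    (hr : r ∈ I ^ (c + k + 2)) :
    ∃ u ∈ I ^ (c + 1), ∃ a : Fin n → PSeries R n, (∀ i, a i ∈ I ^ (c + 2)) ∧
      r = u * f + ∑ i, a i * pderiv R i f := by
  have hle : I ^ (c + k + 2) ≤ I ^ (c + 1) * Ideal.span {f} ⊔ I ^ (c + 2) * jacobianIdeal f := by
    calc I ^ (c + k + 2) = I ^ c * I ^ (k + 2) := by ring
      _ ≤ I ^ c * (I * Ideal.span {f} + I ^ 2 * jacobianIdeal f) := Ideal.mul_mono_right h
      _ = I ^ (c + 1) * Ideal.span {f} + I ^ (c + 2) * jacobianIdeal f := by ring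
  obtain ⟨y, hy, z, hz, rfl⟩ := Submodule.mem_sup.1 (hle hr)
  obtain ⟨u, hu, rfl⟩ := Ideal.mem_mul_span_singleton.1 hy
  obtain ⟨a, ha, rfl⟩ := (Submodule.mem_ideal_smul_span_iff_exists_sum _ _ _).1 hz
  refine ⟨u, hu, a, ha, ?_⟩
  rw [Finsupp.sum_fintype _ _ (by simp)]
  simp

/-- Here c is the current level, and j its excess over the initial level k - o. The new error lies
in I^(o+2c+3) = I^(c+k+j+3), of which one extra order is kept. -/
theorem exists_correction [IsLocalRing R] [IsNoetherianRing R] [IsAdicComplete (maximalIdeal R) R]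
    {I : Ideal (PSeries R n)} (hI : I ≠ ⊤) {f : PSeries R n} {k c j o : ℕ} (hf : f ∈ I ^ (o + 1))
    (h : I ^ (k + 2) ≤ I * Ideal.span {f} + I ^ 2 * jacobianIdeal f) (hc : o + c = k + j)
    {r : PSeries R n} (hr : r ∈ I ^ (c + k + 2)) :
    ∃ u ∈ I ^ (c + 1), ∃ e : PSeries R n ≃ₐ[R] PSeries R n, (∀ i, e (X i) - X i ∈ I ^ (c + 2)) ∧
      f + r - (1 + u) * e f ∈ I ^ (c + k + 3) := by
  obtain ⟨u, hu, a, ha, rfl⟩ := exists_eq_mul_add_sum h hr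
  obtain ⟨D, hDapp⟩ : ∃ D : Derivation R (PSeries R n) (PSeries R n),
      ∀ p, D p = ∑ i, a i * pderiv R i p := ⟨∑ i, a i • pderiv R i, fun p => by
    rw [← Derivation.coeFnAddMonoidHom_apply, map_sum, Finset.sum_apply]; rfl⟩
  have hD : ∀ p, D p ∈ I ^ (c + 2) := fun p => by
    rw [hDapp]; exact Ideal.sum_mem _ fun i _ => Ideal.mul_mem_right _ _ (ha i)
  have hDX : ∀ i, D (X i) = a i := fun i => by
    rw [hDapp, Finset.sum_eq_single i (fun j _ hj => by rw [pderiv_X_of_ne hj.symm, mul_zero])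
      (by simp), pderiv_X_self, mul_one]
  obtain ⟨e, he⟩ := exists_algEquiv_apply_X hI (fun i => X i + a i) fun i => by
    rw [add_sub_cancel_left]; exact Ideal.pow_le_pow_right (by omega) (ha i)
  refine ⟨u, hu, e, fun i => by rw [he, add_sub_cancel_left]; exact ha i, ?_⟩
  have hT := AlgHom.taylorRemainder_mem_pow (φ := (e : PSeries R n →ₐ[R] PSeries R n)) (by omega) hD
    (fun p => by
      rw [mul_comm, pow_mul]
      exact taylorRemainder_mem_sq (φ := (e : PSeries R n →ₐ[R] PSeries R n))
        (fun i => by rw [hDX]; exact he i)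
        (fun ht => hI (Ideal.pow_eq_top_iff.1 ht |>.resolve_right (by omega))) hD p) hf
  have hDf := D.apply_mem_mul_pow hD hf
  have huD := Ideal.mul_mem_mul hu hDf
  rw [← pow_add, ← pow_add] at huD
  have key : f + (u * f + ∑ i, a i * pderiv R i f) - (1 + u) * e f =
      -(u * D f) - (1 + u) * AlgHom.taylorRemainder (e : PSeries R n →ₐ[R] PSeries R n) D f := by
    rw [AlgHom.taylorRemainder_apply, ← hDapp, AlgEquiv.coe_toAlgHom]
    ring
  rw [key]
  exact sub_mem (neg_mem (Ideal.pow_le_pow_right (by omega) huD))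
    (Ideal.mul_mem_left _ _ (Ideal.pow_le_pow_right (by omega) hT))

theorem isUnit_of_sub_one_mem {A : Type*} [CommRing A] [IsLocalRing A] {I : Ideal A} (hI : I ≠ ⊤)
    {w : A} (hw : w - 1 ∈ I) : IsUnit w := by
  by_contra h
  have := sub_mem ((mem_maximalIdeal w).2 h) (le_maximalIdeal hI hw)
  rw [sub_sub_cancel] at this
  exact (Ideal.ne_top_iff_one _).1 (Ideal.IsPrime.ne_top inferInstance) this

/-- `w` and `e` witness the contact equivalence of `f` and `g` modulo `I ^ m`. -/
structure IsApproxContact (I : Ideal (PSeries R n)) (f g : PSeries R n) (m : ℕ)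
    (x : PSeries R n × (PSeries R n ≃ₐ[R] PSeries R n)) : Prop where
  unit_sub_one_mem : x.1 - 1 ∈ I
  apply_X_sub_mem : ∀ i, x.2 (X i) - X i ∈ I ^ 2
  sub_mem : g - x.1 * x.2 f ∈ I ^ m

/-- Transporting the error back by w⁻¹ and e⁻¹ makes it a perturbation of f itself, so the tangent
condition is only ever used at f. If f + r ≈ (1 + u) d(f), applying e and multiplying by w gives the
new pair. -/
theorem IsApproxContact.exists_succ [IsLocalRing R] [IsNoetherianRing R]
    [IsAdicComplete (maximalIdeal R) R]
    {I : Ideal (PSeries R n)} (hI : I ≠ ⊤) {f g : PSeries R n} {k c j o : ℕ} (hf : f ∈ I ^ (o + 1))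
    (h : I ^ (k + 2) ≤ I * Ideal.span {f} + I ^ 2 * jacobianIdeal f) (hc : o + c = k + j)
    {x : PSeries R n × (PSeries R n ≃ₐ[R] PSeries R n)}
    (hx : IsApproxContact I f g (c + k + 2) x) :
    ∃ y, IsApproxContact I f g (c + k + 3) y ∧ y.1 - x.1 ∈ I ^ (c + 1) ∧
      ∀ i, y.2 (X i) - x.2 (X i) ∈ I ^ (c + 2) := by
  obtain ⟨w, e⟩ := x
  obtain ⟨hw, heX, hg⟩ := hx
  dsimp only at hw heX hg
  have he : ∀ p, e p - p ∈ I := fun p =>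
    Ideal.pow_le_self two_ne_zero (algEquiv_sub_mem hI two_ne_zero heX p)
  obtain ⟨v, hv⟩ := (isUnit_of_sub_one_mem hI hw).exists_left_inv
  have hr : e.symm (v * (g - w * e f)) ∈ I ^ (c + k + 2) :=
    AlgEquiv.apply_mem_pow_of_sub_mem (AlgEquiv.symm_sub_mem he) (Ideal.mul_mem_left _ _ hg)
  obtain ⟨u, hu, d, hd, hfd⟩ := exists_correction hI hf h hc hr
  have heu := AlgEquiv.apply_mem_pow_of_sub_mem he hu
  refine ⟨(w * (1 + e u), d.trans e), ⟨?_, fun i => ?_, ?_⟩, ?_, fun i => ?_⟩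
  · rw [show w * (1 + e u) - 1 = (w - 1) + w * e u by ring]
    exact add_mem hw (Ideal.mul_mem_left _ _ (Ideal.pow_le_self (by omega) heu))
  · change e (d (X i)) - X i ∈ I ^ 2
    rw [← sub_add_sub_cancel _ (e (X i)), ← map_sub]
    exact add_mem (Ideal.pow_le_pow_right (by omega)
      (AlgEquiv.apply_mem_pow_of_sub_mem he (hd i))) (heX i)
  · change g - w * (1 + e u) * e (d f) ∈ _
    have h1 := Ideal.mul_mem_left _ w (AlgEquiv.apply_mem_pow_of_sub_mem he hfd)
    rw [map_sub, map_add, e.apply_symm_apply, map_mul, map_add, map_one] at h1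
    have h2 : g - w * (1 + e u) * e (d f) =
        w * (e f + v * (g - w * e f) - (1 + e u) * e (d f)) := by
      linear_combination (-(g - w * e f)) * hv
    rwa [h2]
  · rw [show w * (1 + e u) - w = w * e u by ring]
    exact Ideal.mul_mem_left _ _ heu
  · change e (d (X i)) - e (X i) ∈ _
    rw [← map_sub]
    exact AlgEquiv.apply_mem_pow_of_sub_mem he (hd i)

theorem exists_eq_mul_apply [IsLocalRing R] [IsNoetherianRing R] [IsAdicComplete (maximalIdeal R) R]
    {I : Ideal (PSeries R n)} (hI : I ≠ ⊤) {f g : PSeries R n} {k c o : ℕ} (hf : f ∈ I ^ (o + 1))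
    (h : I ^ (k + 2) ≤ I * Ideal.span {f} + I ^ 2 * jacobianIdeal f) (hc : o + c = k)
    (hg : g - f ∈ I ^ (c + k + 2)) :
    ∃ w : PSeries R n, w - 1 ∈ I ∧ ∃ e : PSeries R n ≃ₐ[R] PSeries R n,
      (∀ p, e p - p ∈ I ^ 2) ∧ g = w * e f := by
  have hstep : ∀ j x, IsApproxContact I f g (c + j + k + 2) x →
      ∃ y, IsApproxContact I f g (c + (j + 1) + k + 2) y ∧ y.1 - x.1 ∈ I ^ (c + j + 1) ∧
        ∀ i, y.2 (X i) - x.2 (X i) ∈ I ^ (c + j + 2) := fun j x hx => by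
    rw [show c + (j + 1) + k + 2 = c + j + k + 3 by ring]
    exact hx.exists_succ (j := j) hI hf h (by omega)
  choose! F hF hF1 hF2 using hstep
  let x : ℕ → PSeries R n × (PSeries R n ≃ₐ[R] PSeries R n) :=
    fun j => Nat.rec (1, AlgEquiv.refl) F j
  have hx : ∀ j, IsApproxContact I f g (c + j + k + 2) (x j) := by
    intro j
    induction j with
    | zero => exact ⟨by simp [x], by simp [x], by simpa [x] using hg⟩
    | succ j ih => exact hF j _ ih
  obtain ⟨w, hw⟩ := exists_forall_sub_mem_pow hI (y := fun j => (x j).1) fun j =>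
    Ideal.pow_le_pow_right (by omega) (hF1 j _ (hx j))
  have hlim : ∀ i, ∃ l, ∀ j, l - (x j).2 (X i) ∈ I ^ j := fun i =>
    exists_forall_sub_mem_pow hI (y := fun j => (x j).2 (X i)) fun j =>
      Ideal.pow_le_pow_right (by omega) (hF2 j _ (hx j) i)
  choose b hb using hlim
  -- Stage 2 is compared with the limit because agreement modulo I² is what makes the limiting
  -- substitution invertible.
  obtain ⟨e, he⟩ := exists_algEquiv_apply_X hI b fun i => by
    rw [← sub_add_sub_cancel _ ((x 2).2 (X i))]
    exact add_mem (hb i 2) ((hx 2).apply_X_sub_mem i)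
  have heX : ∀ i, e (X i) - X i ∈ I ^ 2 := fun i => by
    rw [← sub_add_sub_cancel _ ((x 2).2 (X i)), he]
    exact add_mem (hb i 2) ((hx 2).apply_X_sub_mem i)
  have hM : ∀ e : PSeries R n ≃ₐ[R] PSeries R n, (∀ i, e (X i) - X i ∈ I ^ 2) →
      ∀ i, (e : PSeries R n →ₐ[R] PSeries R n) (X i) ∈ maximalIdeal (PSeries R n) := by
    intro e he i
    change e (X i) ∈ _
    rw [← sub_add_cancel (e (X i)) (X i)]
    exact add_mem (le_maximalIdeal hI (Ideal.pow_le_self two_ne_zero (he i)))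
      (X_mem_maximalIdeal i)
  refine ⟨w, ?_, e, algEquiv_sub_mem hI two_ne_zero heX,
    sub_eq_zero.1 (Ideal.eq_zero_of_forall_mem_pow hI fun j => ?_)⟩
  · rw [← sub_add_sub_cancel _ (x 1).1]
    exact add_mem (by simpa using hw 1) (hx 1).unit_sub_one_mem
  · have h1 : e f - (x j).2 f ∈ I ^ j :=
      sub_mem_of_X_sub_mem (φ := (e : PSeries R n →ₐ[R] PSeries R n))
        (ψ := ((x j).2 : PSeries R n →ₐ[R] PSeries R n)) (hM e heX)
        (hM _ (hx j).apply_X_sub_mem) (fun i => by simpa [he] using hb i j) f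
    have h2 : g - (x j).1 * (x j).2 f ∈ I ^ j :=
      Ideal.pow_le_pow_right (by omega) (hx j).sub_mem
    have h3 : g - w * e f = g - (x j).1 * (x j).2 f - (w - (x j).1) * (x j).2 f
        - w * (e f - (x j).2 f) := by ring
    rw [h3]
    exact sub_mem (sub_mem h2 (Ideal.mul_mem_right _ _ (hw j))) (Ideal.mul_mem_left _ _ h1)

theorem mem_autGroup_of_sub_mem {I : Ideal (PSeries R n)} {e : PSeries R n ≃ₐ[R] PSeries R n}
    (he : ∀ p, e p - p ∈ I) : e ∈ autGroup I := by
  have hiff : ∀ p, e p ∈ I ↔ p ∈ I := fun p => by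
    rw [← sub_add_cancel (e p) p]
    exact Ideal.add_mem_iff_right _ (he p)
  change e '' (I : Set (PSeries R n)) = I
  ext p
  constructor
  · rintro ⟨q, hq, rfl⟩
    exact (hiff q).2 hq
  · exact fun hp => ⟨e.symm p, (hiff _).1 (by simpa using hp), by simp⟩

end Determinacy

theorem theorem2p3 {R : Type*} [CommRing R] [IsLocalRing R] [IsNoetherianRing R]
    [IsAdicComplete (IsLocalRing.maximalIdeal R) R] (n k : ℕ)
    (I : Ideal (MvPowerSeries (Fin n) R)) (hI : I ≠ ⊤)
    (f : MvPowerSeries (Fin n) R) (hf0 : f ≠ 0) (hf : f ∈ I ^ 2)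
    (h : I ^ (k + 2) ≤ I * Ideal.span {f} + I ^ 2 * Determinacy.jacobianIdeal f) :
    Determinacy.ordI I f ≤ 2 * k + 2 ∧
      Determinacy.IsDetermined I (2 * k + 2 - Determinacy.ordI I f) f := by
  have hgr := Determinacy.isGreatest_ordI hI hf0
  generalize Determinacy.ordI I f = m at hgr ⊢
  have hfm : f ∈ I ^ m := hgr.1
  have hm2 : 2 ≤ m := hgr.2 hf
  have hmk : m ≤ k + 1 := Determinacy.le_of_mem_pow hI hf0 h hfm
  -- With these o and c, the exponent N + 1 becomes c + k + 2, the starting level of the iteration.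
  obtain ⟨o, rfl⟩ : ∃ o, m = o + 1 := ⟨m - 1, by omega⟩
  obtain ⟨c, rfl⟩ : ∃ c, k = o + c := ⟨k - o, by omega⟩
  refine ⟨by omega, fun g hg => ?_⟩
  have hgf : g - f ∈ I ^ (c + (o + c) + 2) := by
    rw [← neg_mem_iff, neg_sub]
    exact Ideal.pow_le_pow_right (by omega) hg
  have hfI : f ∈ I := Ideal.pow_le_self two_ne_zero hf
  have hgI : g ∈ I := by
    rw [← sub_add_cancel g f]
    exact add_mem (Ideal.pow_le_self (by omega) hgf) hfI
  obtain ⟨w, hw, e, he, rfl⟩ := Determinacy.exists_eq_mul_apply hI hfm h rfl hgf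
  refine ⟨hfI, hgI, e.symm, inv_mem (Determinacy.mem_autGroup_of_sub_mem fun p =>
    Ideal.pow_le_self two_ne_zero (he p)), ?_⟩
  rw [map_mul, e.symm_apply_apply, eq_comm, mul_comm]
  exact Ideal.span_singleton_mul_right_unit ((Determinacy.isUnit_of_sub_one_mem hI hw).map e.symm) f
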